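/- A plane map is a finite graph $G$ (not necessarily connected; loops and parallel edges are allowed) together with a fixed embedding in the plane, described combinatorially: for each vertex the cyclic order of the edge ends around it, and for each face, including the unbounded outer face, the boundary walks that form its boundary. It is outerplanar if every vertex lies on the boundary of the outer face. The vertex-face incidence poset of $G$ is the poset whose elements are the vertices and all the faces (including the outer face) of $G$, and whose only strict relations are $v<f$ for a vertex $v$ on the boundary of a face $f$. A SegRay graph is the intersection graph of a family of horizontal segments and of vertical rays in $\mathbb{R}^2$, all rays pointing in the same direction, in which no two distinct segments intersect and no two distinct rays intersect. **Proposition.** If $G$ is an outerplanar map, then the comparability graph of the vertex-face incidence poset of $G$ (that is, the bipartite graph on the vertices and faces of $G$ in which a vertex is adjacent to the faces it is incident to) is a SegRay graph. -/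

import Mathlib

/-- A finite graph with vertex set `V` (loops, parallel edges, isolated vertices and several
components are allowed) given by its set `D` of darts (edges with a direction), together with a
rotation system and an assignment of its boundary walks to a set `F` of faces.

* `vert d` is the tail of the dart `d`, and `inv d` is the same edge in the other direction.
* `rot` sends a dart to the next one in the cyclic order around its tail.
* The boundary walks are the orbits of `d ↦ rot (inv d)` and, for an isolated vertex, the trivial
  walk at this vertex. As the graph may be disconnected, a face may have several boundary walks.
* `outer` is the unbounded face. -/
structure FacedMap (V D F : Type*) where
  inv : D → D
  inv_inv : ∀ d, inv (inv d) = d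
  inv_ne : ∀ d, inv d ≠ d
  vert : D → V
  rot : Equiv.Perm D
  vert_eq_iff : ∀ d e, vert d = vert e ↔ rot.SameCycle d e
  dartFace : D → F
  dartFace_next : ∀ d, dartFace (rot (inv d)) = dartFace d
  isolatedFace : {v : V // ∀ d, vert d ≠ v} → F
  outer : F

namespace FacedMap

variable {V D F : Type*} (M : FacedMap V D F)

/-- The vertex `v` lies on the boundary of the face `f`. -/
def Incident (v : V) (f : F) : Prop :=
  (∃ d, M.vert d = v ∧ M.dartFace d = f) ∨
    ∃ h : ∀ d, M.vert d ≠ v, M.isolatedFace ⟨v, h⟩ = f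

/-- Adjacency of distinct vertices in the underlying graph. -/
def underlyingGraph : SimpleGraph V :=
  SimpleGraph.fromRel fun u v => ∃ d, M.vert d = u ∧ M.vert (M.inv d) = v

/-- The ground set of the vertex-face incidence poset: the vertices and all the faces, the outer
face included. -/
@[nolint unusedArguments]
def VertexFace (_ : FacedMap V D F) : Type _ := V ⊕ F

/-- The vertex-face incidence poset: a vertex is below the faces it is incident to, and there are
no other strict relations. -/
instance : PartialOrder M.VertexFace where
  le x y := x = y ∨ ∃ v f, x = Sum.inl v ∧ y = Sum.inr f ∧ M.Incident v f
  le_refl _ := Or.inl rfl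
  le_trans := by
    rintro x y z (rfl | ⟨v, f, rfl, rfl, h⟩) (rfl | ⟨v', f', h1, rfl, h'⟩)
    · exact Or.inl rfl
    · exact Or.inr ⟨v', f', h1, rfl, h'⟩
    · exact Or.inr ⟨v, f, rfl, rfl, h⟩
    · cases h1
  le_antisymm := by
    rintro x y (rfl | ⟨v, f, rfl, rfl, h⟩) (h2 | ⟨v', f', h1, h2, h'⟩)
    · rfl
    · rfl
    · exact h2.symm
    · cases h1

end FacedMap

/-- The comparability graph of a poset. -/
def comparabilityGraph (P : Type*) [PartialOrder P] : SimpleGraph P :=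
  SimpleGraph.fromRel fun x y => x ≤ y

/-- A plane map: a finite graph with a fixed embedding in the plane, in combinatorial form.

For a connected graph the Euler formula says that the rotation system has genus `0`. In general
the two conditions together say that every component has genus `0` and that components and faces
are arranged in a tree, which is how the components of a graph drawn in the plane lie in the faces
of each other. Note that `Nat.card D` is twice the number of edges; the Euler formula is
`|V| + |F| = |E| + |C| + 1` with `C` the set of components. -/
structure PlaneMap (V D F : Type*) extends FacedMap V D F where
  connected : (comparabilityGraph toFacedMap.VertexFace).Connected
  euler : 2 * Nat.card V + 2 * Nat.card F =
    Nat.card D + 2 * Nat.card toFacedMap.underlyingGraph.ConnectedComponent + 2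

/-- A plane map is outerplanar if every vertex lies on the outer face. -/
def PlaneMap.IsOuterplanar {V D F : Type*} (M : PlaneMap V D F) : Prop :=
  ∀ v, M.Incident v M.outer

/-- A horizontal segment of positive length. -/
def IsHorizontalSegment (s : Set (ℝ × ℝ)) : Prop :=
  ∃ a b y : ℝ, a < b ∧ s = {p | a ≤ p.1 ∧ p.1 ≤ b ∧ p.2 = y}

/-- A vertical ray that is directed upward. -/
def IsUpwardRay (s : Set (ℝ × ℝ)) : Prop :=
  ∃ x y : ℝ, s = {p | p.1 = x ∧ y ≤ p.2}

/-- A SegRay graph: an intersection graph of horizontal segments and vertical rays, all rays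
directed in the same direction (upward, without loss of generality), where parallel objects are
disjoint. -/
def IsSegRayGraph {X : Type*} (H : SimpleGraph X) : Prop :=
  ∃ R : X → Set (ℝ × ℝ),
    (∀ x, IsHorizontalSegment (R x) ∨ IsUpwardRay (R x)) ∧
    (∀ x y, x ≠ y →
      (IsHorizontalSegment (R x) ∧ IsHorizontalSegment (R y)) ∨
        (IsUpwardRay (R x) ∧ IsUpwardRay (R y)) →
      Disjoint (R x) (R y)) ∧
    ∀ x y, H.Adj x y ↔ x ≠ y ∧ (R x ∩ R y).Nonempty

/-! A corner is a dart or an isolated vertex. On corners let σ be the rotation, α the edge flip and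
φ = σα. Cycles of σ are vertices, cycles of φ are boundary walks, orbits of ⟨σ, α⟩ are components,
and the genus is nonnegative (`cycleCount_add_le`). If every vertex is outer, each component has a
walk on the outer face and each inner face has a walk. Euler's formula makes this count tight: the
genus is 0, and these are all the walks (`walks_of_euler`).

Order the vertices along the outer walk of their component, one component after another. Then
distinct inner faces f, g never interleave: if v₁ < v₂ < v₃ < v₄ with v₁, v₃ on f and v₂, v₄ on g, a
closed curve through f and the outer face meeting the graph only in v₁ and v₃ would separate v₂ from
v₄, although both lie on g's walk. Combinatorially, the curve is replaced by splitting the vertices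
v₁ and v₃ (`not_crossing_of_genus_zero`).

A face becomes a segment over the span of its vertices, a vertex an upward ray starting at its
lowest face. The ray must miss f if its vertex lies in a gap of an inner face f. By noncrossing, any
inner g with a vertex there stays between the two ends of that gap, so g has a shorter span, or the
same span and more vertices. Putting long spans low and the outer face on top places g above f
(`exists_height`). -/

open Equiv Equiv.Perm

/-! ### Merging two classes of an equivalence relation -/

section Counting

variable {K : Type*}

/-- The number of classes of an equivalence relation. -/
noncomputable def Setoid.numClasses (r : Setoid K) : ℕ := Nat.card (Quotient r)

/-- The equivalence relation obtained from `r` by merging the classes of `x` and `y`. -/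
def Setoid.merge (r : Setoid K) (x y : K) : Setoid K where
  r a b := r a b ∨ (r a x ∨ r a y) ∧ (r b x ∨ r b y)
  iseqv := by
    refine ⟨fun a => Or.inl (r.refl a), ?_, ?_⟩
    · rintro a b (h | ⟨h, h'⟩)
      · exact Or.inl (r.symm h)
      · exact Or.inr ⟨h', h⟩
    · rintro a b c (h | ⟨h, h'⟩) (k | ⟨k, k'⟩)
      · exact Or.inl (r.trans h k)
      · exact Or.inr ⟨k.imp (r.trans h) (r.trans h), k'⟩
      · exact Or.inr ⟨h, h'.imp (r.trans (r.symm k)) (r.trans (r.symm k))⟩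
      · exact Or.inr ⟨h, k'⟩

namespace Setoid

variable {r s : Setoid K} {x y : K}

theorem merge_le_iff : r.merge x y ≤ s ↔ r ≤ s ∧ s x y := by
  constructor
  · intro h
    exact ⟨fun a b hab => h (Or.inl hab),
      h (Or.inr ⟨Or.inl (r.refl x), Or.inr (r.refl y)⟩)⟩
  · rintro ⟨h, hxy⟩ a b (hab | ⟨ha, hb⟩)
    · exact h hab
    · have key : ∀ c, r c x ∨ r c y → s c x := by
        rintro c (hc | hc)
        · exact h hc
        · exact s.trans (h hc) (s.symm hxy)
      exact s.trans (key a ha) (s.symm (key b hb))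

theorem le_merge : r ≤ r.merge x y := (merge_le_iff.1 le_rfl).1

theorem merge_rel : r.merge x y x y := (merge_le_iff.1 le_rfl).2

theorem merge_eq_self (h : r x y) : r.merge x y = r :=
  le_antisymm (merge_le_iff.2 ⟨le_rfl, h⟩) le_merge

/-- Both sides are the least equivalence relation above `r` and `s` that relates `x` and `y`. -/
theorem merge_sup : (r ⊔ s).merge x y = r.merge x y ⊔ s := by
  refine le_antisymm (merge_le_iff.2 ⟨sup_le_sup_right le_merge s, ?_⟩) (sup_le ?_ ?_)
  · exact (le_sup_left : r.merge x y ≤ _) merge_rel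
  · exact merge_le_iff.2 ⟨le_sup_left.trans le_merge, merge_rel⟩
  · exact le_sup_right.trans le_merge

theorem numClasses_merge [Finite K] (h : ¬ r x y) :
    (r.merge x y).numClasses + 1 = r.numClasses := by
  classical
  -- After merging, the class of `x` also represents that of `y`, so dropping the latter loses
  -- nothing.
  have e : {q : Quotient r // q ≠ Quotient.mk r y} ≃ Quotient (r.merge x y) := by
    refine Equiv.ofBijective
      (fun q => Quotient.map' (s₁ := r) (s₂ := r.merge x y) id (fun a b hab => le_merge hab) q.1)
      ⟨?_, ?_⟩
    · rintro ⟨p, hp⟩ ⟨q, hq⟩ hpq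
      induction p using Quotient.inductionOn with | _ a
      induction q using Quotient.inductionOn with | _ b
      have ha : ¬ r a y := fun h => hp (Quotient.sound h)
      have hb : ¬ r b y := fun h => hq (Quotient.sound h)
      have hab : r.merge x y a b := Quotient.exact hpq
      refine Subtype.ext (Quotient.sound ?_)
      rcases hab with hab | ⟨h1, h2⟩
      · exact hab
      · exact r.trans (h1.resolve_right ha) (r.symm (h2.resolve_right hb))
    · intro q
      induction q using Quotient.inductionOn with | _ a
      by_cases ha : r a y
      · refine ⟨⟨Quotient.mk r x, fun h' => h (Quotient.exact h')⟩, Quotient.sound ?_⟩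
        exact Or.inr ⟨Or.inl (r.refl x), Or.inr ha⟩
      · exact ⟨⟨Quotient.mk r a, fun h' => ha (Quotient.exact h')⟩, rfl⟩
  rw [numClasses, numClasses, ← Nat.card_congr e, ← Finite.card_option]
  exact Nat.card_congr (Equiv.optionSubtypeNe _)

theorem numClasses_bot : (⊥ : Setoid K).numClasses = Nat.card K :=
  Nat.card_congr (Setoid.quotientBotEquiv (α := K))

theorem numClasses_le_card [Finite K] : r.numClasses ≤ Nat.card K :=
  Nat.card_le_card_of_surjective _ Quotient.mk_surjective

end Setoid

end Counting

/-! ### Cycles of a permutation multiplied by a transposition -/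

section Cycles

variable {K : Type*}

/-- The number of cycles of a permutation, fixed points included. -/
noncomputable def cycleCount (σ : Perm K) : ℕ := (SameCycle.setoid σ).numClasses

theorem pow_apply_eq_of_eqOn {σ ψ : Perm K} {a : K} {m : ℕ}
    (h : ∀ j < m, ψ ((σ ^ j) a) = σ ((σ ^ j) a)) : (ψ ^ m) a = (σ ^ m) a := by
  induction m with
  | zero => rfl
  | succ m ih =>
    rw [pow_succ', pow_succ', Perm.mul_apply, Perm.mul_apply, ih fun j hj => h j (by omega),
      h m (by omega)]

theorem sameCycle_setoid_le_iff {σ : Perm K} {r : Setoid K} :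
    SameCycle.setoid σ ≤ r ↔ ∀ a, r a (σ a) := by
  constructor
  · intro h a
    exact h (show SameCycle σ a (σ a) from ⟨1, by simp⟩)
  · rintro h a b ⟨n, rfl⟩
    induction n with
    | zero => exact r.refl a
    | succ n ih =>
      rw [add_comm, zpow_add, zpow_one]
      exact r.trans ih (h _)
    | pred n ih =>
      refine r.trans ih (r.symm ?_)
      have := h ((σ ^ (-(n : ℤ) - 1)) a)
      rwa [← Perm.mul_apply, ← zpow_one_add, add_sub_cancel] at this

variable [DecidableEq K] {σ : Perm K} {x y : K}

theorem sameCycle_swap_mul_merge_le :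
    (SameCycle.setoid (swap x y * σ)).merge x y ≤ (SameCycle.setoid σ).merge x y := by
  refine Setoid.merge_le_iff.2 ⟨sameCycle_setoid_le_iff.2 fun a => ?_, Setoid.merge_rel⟩
  have h1 : (SameCycle.setoid σ).merge x y a (σ a) :=
    Setoid.le_merge (show SameCycle σ a (σ a) from ⟨1, by simp⟩)
  rw [Perm.mul_apply]
  by_cases hx : σ a = x
  · rw [hx, swap_apply_left]
    rw [hx] at h1
    exact Setoid.trans' _ h1 Setoid.merge_rel
  by_cases hy : σ a = y
  · rw [hy, swap_apply_right]
    rw [hy] at h1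
    exact Setoid.trans' _ h1 (Setoid.symm' _ Setoid.merge_rel)
  rwa [swap_apply_of_ne_of_ne hx hy]

/-- The two permutations differ only by exchanging the values `x` and `y`, which is invisible once
these are identified. Multiplying by the transposition again gives the reverse inclusion. -/
theorem sameCycle_swap_mul_merge :
    (SameCycle.setoid (swap x y * σ)).merge x y = (SameCycle.setoid σ).merge x y := by
  refine le_antisymm sameCycle_swap_mul_merge_le ?_
  conv_lhs => rw [← swap_mul_self_mul x y σ]
  exact sameCycle_swap_mul_merge_le

theorem sameCycle_sup_swap_mul_merge (α : Perm K) :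
    (SameCycle.setoid (swap x y * σ) ⊔ SameCycle.setoid α).merge x y =
      (SameCycle.setoid σ ⊔ SameCycle.setoid α).merge x y := by
  rw [Setoid.merge_sup, Setoid.merge_sup, sameCycle_swap_mul_merge]

variable [Finite K]

/-- The new orbit of `x` follows the old cycle, which avoids `y`, until the step that would return
to `x`; the transposition redirects that step to `y`. -/
theorem sameCycle_swap_mul_of_not (h : ¬ SameCycle σ x y) : SameCycle (swap x y * σ) x y := by
  have hex : ∃ m, 0 < m ∧ (σ ^ m) x = x := ⟨orderOf σ, orderOf_pos σ, by simp [pow_orderOf_eq_one]⟩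
  classical
  obtain ⟨hpos, hm⟩ := Nat.find_spec hex
  set m := Nat.find hex with hmdef
  have key : ((swap x y * σ) ^ (m - 1)) x = (σ ^ (m - 1)) x := by
    refine pow_apply_eq_of_eqOn fun j hj => ?_
    have e : σ ((σ ^ j) x) = (σ ^ (j + 1)) x := by rw [pow_succ', Perm.mul_apply]
    rw [Perm.mul_apply, e]
    refine swap_apply_of_ne_of_ne (fun hx => ?_) (fun hy => ?_)
    · exact Nat.find_min hex (show j + 1 < m by omega) ⟨by omega, hx⟩
    · exact h ⟨(j + 1 : ℕ), by rw [zpow_natCast]; exact hy⟩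
  refine ⟨(m : ℕ), ?_⟩
  obtain ⟨n, hn⟩ : ∃ n, m = n + 1 := ⟨m - 1, by omega⟩
  rw [hn] at key hm ⊢
  rw [Nat.add_sub_cancel] at key
  rw [zpow_natCast, pow_succ', Perm.mul_apply, key, Perm.mul_apply, ← Perm.mul_apply σ,
    ← pow_succ', hm, swap_apply_left]

/-- The step that would first reach `y` is redirected to `x`, so the new orbit of `x` is confined to
the stretch of the old cycle before `y`. -/
theorem not_sameCycle_swap_mul (hne : x ≠ y) (h : SameCycle σ x y) :
    ¬ SameCycle (swap x y * σ) x y := by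
  classical
  have hex : ∃ m : ℕ, (σ ^ m) x = y := h.exists_nat_pow_eq
  have hm := Nat.find_spec hex
  set m := Nat.find hex with hmdef
  have hmin : ∀ j < m, (σ ^ j) x ≠ y := fun j hj => Nat.find_min hex hj
  have hinv : ∀ n : ℕ, ∃ j < m, ((swap x y * σ) ^ n) x = (σ ^ j) x := by
    intro n
    induction n with
    | zero =>
      refine ⟨0, Nat.pos_of_ne_zero fun h0 => hne ?_, rfl⟩
      rw [h0] at hm
      exact hm
    | succ n ih =>
      obtain ⟨j, hj, hn⟩ := ih
      rw [pow_succ', Perm.mul_apply, hn, Perm.mul_apply, ← Perm.mul_apply σ, ← pow_succ']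
      rcases Nat.lt_or_ge (j + 1) m with hlt | hge
      · refine ⟨j + 1, hlt, swap_apply_of_ne_of_ne (fun hx => ?_) (hmin _ hlt)⟩
        refine hmin (m - (j + 1)) (by omega) ?_
        rw [← hm]
        nth_rewrite 1 [← hx]
        rw [← Perm.mul_apply, ← pow_add, Nat.sub_add_cancel hlt.le]
      · have : j + 1 = m := by omega
        rw [this, hm, swap_apply_right]
        exact ⟨0, by omega, rfl⟩
  intro hc
  obtain ⟨n, hn⟩ := hc.exists_nat_pow_eq
  obtain ⟨j, hj, hj'⟩ := hinv n
  exact hmin j hj (hj'.symm.trans hn)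

theorem cycleCount_swap_mul_of_not (h : ¬ SameCycle σ x y) :
    cycleCount (swap x y * σ) + 1 = cycleCount σ := by
  have h1 := Setoid.merge_eq_self (r := SameCycle.setoid (swap x y * σ))
    (sameCycle_swap_mul_of_not h)
  rw [cycleCount, cycleCount, ← Setoid.numClasses_merge (r := SameCycle.setoid σ) h,
    ← sameCycle_swap_mul_merge, h1]

theorem cycleCount_swap_mul (hne : x ≠ y) (h : SameCycle σ x y) :
    cycleCount (swap x y * σ) = cycleCount σ + 1 := by
  have := cycleCount_swap_mul_of_not (not_sameCycle_swap_mul hne h)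
  rwa [swap_mul_self_mul, eq_comm] at this

theorem cycleCount_swap_mul_le : cycleCount (swap x y * σ) ≤ cycleCount σ + 1 := by
  by_cases h : SameCycle σ x y
  · by_cases hne : x = y
    · rw [hne, swap_self, ← Perm.one_def, one_mul]
      exact Nat.le_succ _
    · exact (cycleCount_swap_mul hne h).le
  · have := cycleCount_swap_mul_of_not h
    omega

end Cycles

/-! ### Nonnegativity of the genus -/

section Genus

variable {K : Type*}

/-- The equivalence relation of lying in the same orbit of the group generated by two
permutations. -/
def orbitSetoid (σ α : Perm K) : Setoid K := SameCycle.setoid σ ⊔ SameCycle.setoid α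

variable {σ α : Perm K} {x y : K}

theorem orbitSetoid_of_left (h : SameCycle σ x y) : orbitSetoid σ α x y :=
  (le_sup_left : SameCycle.setoid σ ≤ orbitSetoid σ α) h

theorem orbitSetoid_of_right (h : SameCycle α x y) : orbitSetoid σ α x y :=
  (le_sup_right : SameCycle.setoid α ≤ orbitSetoid σ α) h

theorem orbitSetoid_of_mul (h : SameCycle (σ * α) x y) : orbitSetoid σ α x y := by
  refine (sameCycle_setoid_le_iff (r := orbitSetoid σ α)).2 (fun a => ?_) h
  exact Setoid.trans' _ (orbitSetoid_of_right ⟨1, by simp⟩)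
    (orbitSetoid_of_left (x := α a) ⟨1, by simp⟩)

variable [Finite K] [DecidableEq K]

/-- The genus of a hypermap is nonnegative. -/
theorem cycleCount_add_le (σ α : Perm K) :
    cycleCount σ + cycleCount α + cycleCount (σ * α) ≤
      Nat.card K + 2 * (orbitSetoid σ α).numClasses := by
  -- Splitting cycles of σ reduces to σ = 1, where equality holds.
  induction hn : Nat.card K - cycleCount σ using Nat.strong_induction_on generalizing σ with
  | _ n ih =>
  by_cases h1 : σ = 1
  · subst h1
    have hbot : SameCycle.setoid (1 : Perm K) = ⊥ :=
      le_bot_iff.1 (sameCycle_setoid_le_iff.2 fun a => rfl)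
    have e1 : cycleCount (1 : Perm K) = Nat.card K := by
      rw [cycleCount, hbot, Setoid.numClasses_bot]
    have e2 : orbitSetoid 1 α = SameCycle.setoid α := by rw [orbitSetoid, hbot, bot_sup_eq]
    rw [e1, e2, one_mul, cycleCount]
    omega
  obtain ⟨x, hx⟩ : ∃ x, σ x ≠ x := by
    by_contra! hall
    exact h1 (Equiv.ext hall)
  set y := σ x with hy
  have hxy : x ≠ y := hx.symm
  have hs : SameCycle σ x y := ⟨1, by simp [hy]⟩
  set σ₀ := swap x y * σ with hσ₀
  have hns : ¬ SameCycle σ₀ x y := not_sameCycle_swap_mul hxy hs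
  have hσ : σ = swap x y * σ₀ := (swap_mul_self_mul x y σ).symm
  have hc : cycleCount σ₀ = cycleCount σ + 1 := cycleCount_swap_mul hxy hs
  have hle : cycleCount σ₀ ≤ Nat.card K := Setoid.numClasses_le_card
  have IH := ih _ (by omega) σ₀ rfl
  have hφ : σ * α = swap x y * (σ₀ * α) := by rw [← mul_assoc, ← hσ]
  have hC : orbitSetoid σ α = (orbitSetoid σ₀ α).merge x y := by
    rw [← Setoid.merge_eq_self (orbitSetoid_of_left (α := α) hs), orbitSetoid, orbitSetoid, hσ₀,
      sameCycle_sup_swap_mul_merge]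
  -- Undoing the split either keeps the orbits and gains at most one cycle of σα, or joins two
  -- orbits and hence two cycles of σα.
  by_cases hr : orbitSetoid σ₀ α x y
  · rw [Setoid.merge_eq_self hr] at hC
    have := cycleCount_swap_mul_le (σ := σ₀ * α) (x := x) (y := y)
    rw [hC, hφ]
    omega
  · have h2 := Setoid.numClasses_merge hr
    have h3 := cycleCount_swap_mul_of_not (σ := σ₀ * α) (fun h => hr (orbitSetoid_of_mul h))
    rw [hC, hφ]
    omega

end Genus

/-! ### A combinatorial Jordan curve argument -/

section Crossing

variable {K V F : Type*}

theorem face_eq_of_sameCycle {φ : Perm K} {face : K → F} (hface : ∀ a, face (φ a) = face a)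
    {a b : K} (h : SameCycle φ a b) : face a = face b :=
  (sameCycle_setoid_le_iff (r := Setoid.ker face)).2 (fun a => (hface a).symm) h

variable [Finite K]

theorem sameCycle_of_eqOn {σ ψ : Perm K} {a b : K} (h : SameCycle σ a b)
    (heq : ∀ c, SameCycle σ a c → ψ c = σ c) : SameCycle ψ a b := by
  obtain ⟨n, rfl⟩ := h.exists_nat_pow_eq
  refine ⟨(n : ℕ), ?_⟩
  rw [zpow_natCast]
  exact pow_apply_eq_of_eqOn fun j _ => heq _ ⟨(j : ℕ), by rw [zpow_natCast]⟩

/-- In a hypermap of genus `0`, let `d₁, d₂, d₃, d₄` be corners at different vertices that occur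
in this order on a boundary walk. Then there are no two further different boundary walks, one
through the vertices of `d₁` and `d₃` and one through the vertices of `d₂` and `d₄`. -/
theorem not_crossing_of_genus_zero {σ α : Perm K} {vert : K → V} {face : K → F}
    (hvert : ∀ a b, vert a = vert b ↔ SameCycle σ a b)
    (hface : ∀ a, face ((σ * α) a) = face a)
    (hgenus : Nat.card K + 2 * (orbitSetoid σ α).numClasses ≤
      cycleCount σ + cycleCount α + cycleCount (σ * α))
    {b : K} {n₁ n₂ n₃ n₄ : ℕ} (h₁₂ : n₁ < n₂) (h₂₃ : n₂ < n₃) (h₃₄ : n₃ < n₄)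
    (hinj : ∀ s t, s < t → t ≤ n₄ → ((σ * α) ^ s) b ≠ ((σ * α) ^ t) b)
    {d₁ d₂ d₃ d₄ e₁ e₂ e₃ e₄ : K}
    (hd₁ : ((σ * α) ^ n₁) b = d₁) (hd₂ : ((σ * α) ^ n₂) b = d₂)
    (hd₃ : ((σ * α) ^ n₃) b = d₃) (hd₄ : ((σ * α) ^ n₄) b = d₄)
    (he₁ : vert e₁ = vert d₁) (he₂ : vert e₂ = vert d₂)
    (he₃ : vert e₃ = vert d₃) (he₄ : vert e₄ = vert d₄)
    (hv₁₂ : vert d₁ ≠ vert d₂) (hv₁₃ : vert d₁ ≠ vert d₃) (hv₁₄ : vert d₁ ≠ vert d₄)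
    (hv₂₃ : vert d₂ ≠ vert d₃) (hv₃₄ : vert d₃ ≠ vert d₄)
    (hf₁ : face e₁ ≠ face b) (hf₂ : face e₂ ≠ face b) (hf₁₂ : face e₁ ≠ face e₂)
    (h₁₃ : SameCycle (σ * α) e₁ e₃) (h₂₄ : SameCycle (σ * α) e₂ e₄) : False := by
  classical
  set φ := σ * α with hφ
  have hpow : ∀ n, face ((φ ^ n) b) = face b := fun n =>
    (face_eq_of_sameCycle hface ⟨(n : ℕ), by rw [zpow_natCast]⟩).symm
  have hfd₁ : face d₁ = face b := hd₁ ▸ hpow n₁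
  have hfd₃ : face d₃ = face b := hd₃ ▸ hpow n₃
  have hfe₃ : face e₃ = face e₁ := (face_eq_of_sameCycle hface h₁₃).symm
  have d₁e₁ : d₁ ≠ e₁ := fun h => hf₁ (by rw [← h, hfd₁])
  have d₃e₃ : d₃ ≠ e₃ := fun h => hf₁ (by rw [← hfe₃, ← h, hfd₃])
  have d₃d₁ : d₃ ≠ d₁ := fun h => hv₁₃ (by rw [h])
  have d₃e₁ : d₃ ≠ e₁ := fun h => hf₁ (by rw [← h, hfd₃])
  -- the first cut
  set σ' := swap d₁ e₁ * σ with hσ'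
  have hφ' : σ' * α = swap d₁ e₁ * φ := by rw [hφ, hσ', mul_assoc]
  have hsc₁ : SameCycle σ d₁ e₁ := (hvert _ _).1 he₁.symm
  have hnφ : ¬ SameCycle φ d₁ e₁ := fun h =>
    hf₁ ((face_eq_of_sameCycle hface h).symm.trans hfd₁)
  have c₁ : cycleCount σ' = cycleCount σ + 1 := cycleCount_swap_mul d₁e₁ hsc₁
  have c₂ : cycleCount (σ' * α) + 1 = cycleCount φ := by
    rw [hφ']; exact cycleCount_swap_mul_of_not hnφ
  have hφ'₁ : SameCycle (σ' * α) d₁ e₁ := by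
    rw [hφ']; exact sameCycle_swap_mul_of_not hnφ
  -- The cut joins the two walks through `d₁` and `e₁`, so these corners stay connected.
  have hC' : orbitSetoid σ' α = orbitSetoid σ α := by
    rw [← Setoid.merge_eq_self (orbitSetoid_of_left (α := α) hsc₁),
      ← Setoid.merge_eq_self (orbitSetoid_of_mul hφ'₁), orbitSetoid, orbitSetoid, hσ',
      sameCycle_sup_swap_mul_merge]
  -- cycles of `φ` stay connected after the first cut
  have hφle : ∀ {a c}, SameCycle φ a c → SameCycle φ d₁ a ∨ SameCycle φ e₁ a →
      SameCycle (σ' * α) d₁ c := by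
    intro a c hac ha
    have hm : (SameCycle.setoid φ).merge d₁ e₁ = SameCycle.setoid (σ' * α) := by
      rw [← sameCycle_swap_mul_merge, ← hφ']
      exact Setoid.merge_eq_self hφ'₁
    have : (SameCycle.setoid φ).merge d₁ e₁ d₁ c :=
      Or.inr ⟨Or.inl (SameCycle.refl _ _), ha.imp (fun h => (h.trans hac).symm)
        (fun h => (h.trans hac).symm)⟩
    rw [hm] at this
    exact this
  have hd₁₃ : SameCycle φ d₁ d₃ := by
    refine SameCycle.trans (y := b) (SameCycle.symm ⟨(n₁ : ℕ), ?_⟩) ⟨(n₃ : ℕ), ?_⟩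
    · rw [zpow_natCast, hd₁]
    · rw [zpow_natCast, hd₃]
  have hφ'₃ : SameCycle (σ' * α) d₃ e₃ :=
    (hφle hd₁₃ (Or.inl (SameCycle.refl _ _))).symm.trans
      (hφle h₁₃ (Or.inr (SameCycle.refl _ _)))
  -- the second cut
  set σ'' := swap d₃ e₃ * σ' with hσ''
  have hφ'' : σ'' * α = swap d₃ e₃ * (swap d₁ e₁ * φ) := by rw [hσ'', mul_assoc, hφ']
  have hsc₃ : SameCycle σ' d₃ e₃ := by
    refine sameCycle_of_eqOn ((hvert _ _).1 he₃.symm) fun c hc => ?_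
    have hc' : vert (σ c) = vert d₃ := by
      refine ((hvert _ _).2 ?_).symm
      exact hc.trans ⟨1, by simp⟩
    refine swap_apply_of_ne_of_ne (fun h => ?_) (fun h => ?_)
    · exact hv₁₃ (by rw [← hc', h])
    · exact hv₁₃ (by rw [← hc', h, he₁])
  have c₃ : cycleCount σ'' = cycleCount σ' + 1 := cycleCount_swap_mul d₃e₃ hsc₃
  have c₄ : cycleCount (σ'' * α) = cycleCount (σ' * α) + 1 := by
    rw [hσ'', mul_assoc]; exact cycleCount_swap_mul d₃e₃ hφ'₃
  have hC'' : (orbitSetoid σ'' α).merge d₃ e₃ = orbitSetoid σ α := by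
    rw [← hC', ← Setoid.merge_eq_self (orbitSetoid_of_left (α := α) hsc₃), orbitSetoid,
      orbitSetoid, hσ'', sameCycle_sup_swap_mul_merge]
  -- The two cuts gain two vertices while the number of walks is restored. With unchanged components
  -- this would exceed the genus bound.
  have hsep : ¬ orbitSetoid σ'' α d₃ e₃ := by
    intro h
    rw [Setoid.merge_eq_self h] at hC''
    have := cycleCount_add_le σ'' α
    rw [hC''] at this
    omega
  -- but `d₃` and `e₃` are still connected
  apply hsep
  have hstep : ∀ c, c ≠ d₁ → c ≠ e₁ → c ≠ d₃ → c ≠ e₃ →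
      swap d₃ e₃ (swap d₁ e₁ c) = c := by
    intro c k₁ k₂ k₃ k₄
    rw [swap_apply_of_ne_of_ne k₁ k₂, swap_apply_of_ne_of_ne k₃ k₄]
  have hvertc : ∀ {d e}, vert e = vert d → vert d₁ ≠ vert d → vert d₃ ≠ vert d →
      SameCycle σ'' d e := by
    intro d e hde k₁ k₃
    refine sameCycle_of_eqOn ((hvert _ _).1 hde.symm) fun c hc => ?_
    have hc' : vert (σ c) = vert d := by
      refine ((hvert _ _).2 ?_).symm
      exact hc.trans ⟨1, by simp⟩
    refine hstep _ ?_ ?_ ?_ ?_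
    · exact fun h => k₁ (by rw [← hc', h])
    · exact fun h => k₁ (by rw [← hc', h, he₁])
    · exact fun h => k₃ (by rw [← hc', h])
    · exact fun h => k₃ (by rw [← hc', h, he₃])
  have r₂ : SameCycle σ'' d₂ e₂ := hvertc he₂ hv₁₂ hv₂₃.symm
  have r₄ : SameCycle σ'' d₄ e₄ := hvertc he₄ hv₁₄ hv₃₄
  have r₂₄ : SameCycle (σ'' * α) e₂ e₄ := by
    refine sameCycle_of_eqOn h₂₄ fun c hc => ?_
    have hc' : face (φ c) = face e₂ := by
      rw [hface]; exact (face_eq_of_sameCycle hface hc).symm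
    rw [hφ'']
    refine hstep _ ?_ ?_ ?_ ?_
    · exact fun h => hf₂ (by rw [← hc', h, hfd₁])
    · exact fun h => hf₁₂ (by rw [← hc', h])
    · exact fun h => hf₂ (by rw [← hc', h, hfd₃])
    · exact fun h => hf₁₂ (by rw [← hc', h, hfe₃])
  -- The transpositions act on the corner arrived at, so only arrivals at times `n₁` and `n₃` are
  -- redirected; starting at such a time is harmless.
  have hwalk : ∀ m n, m ≤ n → n ≤ n₄ →
      (∀ t, m < t → t ≤ n → t ≠ n₁ ∧ t ≠ n₃) →
      SameCycle (σ'' * α) ((φ ^ m) b) ((φ ^ n) b) := by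
    intro m n hmn hn ht
    refine ⟨(n - m : ℕ), ?_⟩
    rw [zpow_natCast, pow_apply_eq_of_eqOn (σ := φ), ← Perm.mul_apply, ← pow_add,
      Nat.sub_add_cancel hmn]
    intro j hj
    have e : φ ((φ ^ j) ((φ ^ m) b)) = (φ ^ (m + j + 1)) b := by
      rw [← Perm.mul_apply (φ ^ j), ← pow_add, ← Perm.mul_apply φ, ← pow_succ', add_comm j m]
    have hne : ∀ s ≤ n₄, m + j + 1 ≠ s → (φ ^ (m + j + 1)) b ≠ (φ ^ s) b := by
      intro s hs hne
      rcases Nat.lt_or_gt_of_ne hne with h | h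
      · exact hinj _ _ h hs
      · exact (hinj _ _ h (by omega)).symm
    rw [hφ'', Perm.mul_apply, Perm.mul_apply, e]
    obtain ⟨t₁, t₃⟩ := ht (m + j + 1) (by omega) (by omega)
    refine hstep _ ?_ ?_ ?_ ?_
    · rw [← hd₁]; exact hne _ (by omega) t₁
    · exact fun h => hf₁ (by rw [← h, hpow])
    · rw [← hd₃]; exact hne _ (by omega) t₃
    · exact fun h => hf₁ (by rw [← hfe₃, ← h, hpow])
  have w₁₂ : SameCycle (σ'' * α) d₁ d₂ := by
    rw [← hd₁, ← hd₂]
    exact hwalk _ _ h₁₂.le (by omega) fun t _ _ => by omega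
  have w₃₄ : SameCycle (σ'' * α) d₃ d₄ := by
    rw [← hd₃, ← hd₄]
    exact hwalk _ _ h₃₄.le (by omega) fun t _ _ => by omega
  have w₁₃ : SameCycle (σ'' * α) d₁ e₃ := by
    rw [← hd₁]
    -- The next step of φ would reach `d₃`; the second cut sends it to `e₃`.
    refine (hwalk n₁ (n₃ - 1) (by omega) (by omega) fun t _ _ => by omega).trans ⟨1, ?_⟩
    rw [zpow_one, hφ'', Perm.mul_apply, Perm.mul_apply, ← Perm.mul_apply φ, ← pow_succ',
      Nat.sub_add_cancel (by omega), hd₃, swap_apply_of_ne_of_ne d₃d₁ d₃e₁, swap_apply_left]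
  have q₁ := orbitSetoid_of_mul w₁₂
  have q₂ := orbitSetoid_of_mul w₃₄
  have q₃ := orbitSetoid_of_mul w₁₃
  have q₄ := orbitSetoid_of_mul r₂₄
  have q₅ := orbitSetoid_of_left (α := α) r₂
  have q₆ := orbitSetoid_of_left (α := α) r₄
  let r := orbitSetoid σ'' α
  -- The route is `d₁`, `d₂`, `e₂`, `e₄`, `d₄`, `d₃`, crossing over along the second face.
  have u₁ : r d₁ d₃ :=
    r.trans q₁ (r.trans q₅ (r.trans q₄ (r.trans (r.symm q₆) (r.symm q₂))))
  exact r.trans (r.symm u₁) q₃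

end Crossing

/-! ### The vertex order along outer walks -/

section Order

variable {K V F : Type*} [Finite K] [Finite F]

/-- In an outerplanar hypermap all vertices of which lie on `outer`, every other face has a single
boundary walk, every component has a single boundary walk on `outer`, and the genus is `0`. -/
theorem walks_of_euler {σ α : Perm K} {vert : K → V} {face : K → F} {outer : F}
    (hvert : ∀ a b, vert a = vert b ↔ SameCycle σ a b) (hsurj : Function.Surjective vert)
    (hface : ∀ a, face ((σ * α) a) = face a) (hfsurj : Function.Surjective face)
    (houter : ∀ v, ∃ k, vert k = v ∧ face k = outer)
    (heuler : Nat.card K + (orbitSetoid σ α).numClasses + 1 ≤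
      Nat.card V + cycleCount α + Nat.card F) :
    (∀ a b, face a ≠ outer → face a = face b → SameCycle (σ * α) a b) ∧
    (∀ a b, face a = outer → face b = outer → orbitSetoid σ α a b → SameCycle (σ * α) a b) ∧
    Nat.card K + 2 * (orbitSetoid σ α).numClasses ≤
      cycleCount σ + cycleCount α + cycleCount (σ * α) := by
  classical
  have hbase : ∀ c : Quotient (orbitSetoid σ α), ∃ k, Quotient.mk _ k = c ∧ face k = outer := by
    intro c
    induction c using Quotient.inductionOn with | _ a
    obtain ⟨k, hk, hk'⟩ := houter (vert a)
    exact ⟨k, Quotient.sound (orbitSetoid_of_left ((hvert _ _).1 hk)), hk'⟩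
  choose base hbase hbaseface using hbase
  choose corner hcorner using hfsurj
  let g : Quotient (orbitSetoid σ α) ⊕ {f : F // f ≠ outer} →
      Quotient (SameCycle.setoid (σ * α)) :=
    Sum.elim (fun c => Quotient.mk _ (base c)) (fun f => Quotient.mk _ (corner f.1))
  have hg : Function.Injective g := by
    rintro (c | ⟨f, hf⟩) (c' | ⟨f', hf'⟩) h
    · have h' : SameCycle (σ * α) (base c) (base c') := Quotient.exact h
      rw [← hbase c, ← hbase c']
      exact congrArg Sum.inl (Quotient.sound (orbitSetoid_of_mul h'))
    · have h' : SameCycle (σ * α) (base c) (corner f') := Quotient.exact h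
      have := face_eq_of_sameCycle hface h'
      rw [hbaseface, hcorner] at this
      exact absurd this.symm hf'
    · have h' : SameCycle (σ * α) (corner f) (base c') := Quotient.exact h
      have := face_eq_of_sameCycle hface h'
      rw [hbaseface, hcorner] at this
      exact absurd this hf
    · have h' : SameCycle (σ * α) (corner f) (corner f') := Quotient.exact h
      have := face_eq_of_sameCycle hface h'
      rw [hcorner, hcorner] at this
      subst this
      rfl
  have hF : Nat.card {f : F // f ≠ outer} + 1 = Nat.card F := by
    rw [← Finite.card_option]
    exact Nat.card_congr (Equiv.optionSubtypeNe _)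
  have hdom : Nat.card (Quotient (orbitSetoid σ α) ⊕ {f : F // f ≠ outer}) =
      (orbitSetoid σ α).numClasses + Nat.card {f : F // f ≠ outer} := Nat.card_sum
  have hcard := Nat.card_le_card_of_injective g hg
  have hV : Nat.card V ≤ cycleCount σ := by
    refine Nat.card_le_card_of_surjective
      (Quotient.lift vert fun a b h => (hvert a b).2 h) fun v => ?_
    obtain ⟨a, ha⟩ := hsurj v
    exact ⟨Quotient.mk _ a, ha⟩
  have hgen := cycleCount_add_le σ α
  have hφ : Nat.card (Quotient (SameCycle.setoid (σ * α))) = cycleCount (σ * α) := rfl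
  -- Injectivity bounds the number of walks below by components plus inner faces; the genus bound
  -- and Euler's formula give the same bound from above.
  have hbij : Function.Bijective g :=
    (Nat.bijective_iff_injective_and_card g).2 ⟨hg, by omega⟩
  have hin : ∀ a, face a ≠ outer → SameCycle (σ * α) (corner (face a)) a := by
    intro a ha
    obtain ⟨c | ⟨f, hf⟩, h⟩ := hbij.2 (Quotient.mk _ a)
    · have h' : SameCycle (σ * α) (base c) a := Quotient.exact h
      exact absurd ((face_eq_of_sameCycle hface h').symm.trans (hbaseface c)) ha
    · have h' : SameCycle (σ * α) (corner f) a := Quotient.exact h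
      rwa [← face_eq_of_sameCycle hface h', hcorner]
  have hout : ∀ a, face a = outer → SameCycle (σ * α) (base (Quotient.mk _ a)) a := by
    intro a ha
    obtain ⟨c | ⟨f, hf⟩, h⟩ := hbij.2 (Quotient.mk _ a)
    · have h' : SameCycle (σ * α) (base c) a := Quotient.exact h
      have : c = Quotient.mk _ a := by
        rw [← hbase c]
        exact Quotient.sound (orbitSetoid_of_mul h')
      rwa [← this]
    · have h' : SameCycle (σ * α) (corner f) a := Quotient.exact h
      have := face_eq_of_sameCycle hface h'
      rw [hcorner, ha] at this
      exact absurd this hf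
  refine ⟨fun a b ha hab => ?_, fun a b ha hb hab => ?_, by omega⟩
  · have h := hin b (hab ▸ ha)
    rw [← hab] at h
    exact (hin a ha).symm.trans h
  · have h := hout b hb
    rw [show (Quotient.mk _ b : Quotient (orbitSetoid σ α)) = Quotient.mk _ a from
      (Quotient.sound hab).symm] at h
    exact (hout a ha).symm.trans h

/-- The vertices of an outerplanar hypermap can be ordered linearly in such a way that no two of
its inner faces cross. -/
theorem exists_noncrossing_order {σ α : Perm K} {vert : K → V} {face : K → F} {outer : F}
    (hvert : ∀ a b, vert a = vert b ↔ SameCycle σ a b) (hsurj : Function.Surjective vert)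
    (hface : ∀ a, face ((σ * α) a) = face a) (hfsurj : Function.Surjective face)
    (houter : ∀ v, ∃ k, vert k = v ∧ face k = outer)
    (heuler : Nat.card K + (orbitSetoid σ α).numClasses + 1 ≤
      Nat.card V + cycleCount α + Nat.card F) :
    ∃ pos : V → ℕ, Function.Injective pos ∧
      ∀ e₁ e₂ e₃ e₄ : K, pos (vert e₁) < pos (vert e₂) → pos (vert e₂) < pos (vert e₃) →
        pos (vert e₃) < pos (vert e₄) → face e₁ ≠ outer → face e₂ ≠ outer →
        face e₁ = face e₃ → face e₂ = face e₄ → face e₁ = face e₂ := by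
  classical
  obtain ⟨hin, hout, hgenus⟩ := walks_of_euler hvert hsurj hface hfsurj houter heuler
  choose out hvout hfout using houter
  let comp : V → Quotient (orbitSetoid σ α) := fun v => Quotient.mk _ (out v)
  have hcomp : ∀ k, comp (vert k) = Quotient.mk _ k := fun k =>
    Quotient.sound (orbitSetoid_of_left ((hvert _ _).1 (hvout _)))
  have hbase : ∀ c : Quotient (orbitSetoid σ α), ∃ k, Quotient.mk _ k = c ∧ face k = outer := by
    intro c
    induction c using Quotient.inductionOn with | _ a
    exact ⟨out (vert a), hcomp a, hfout _⟩
  choose base hbase hfbase using hbase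
  have hex : ∀ v, ∃ n : ℕ, ((σ * α) ^ n) (base (comp v)) = out v := fun v =>
    (hout _ _ (hfbase _) (hfout _) (Quotient.exact (hbase _))).exists_nat_pow_eq
  let idx : V → ℕ := fun v => Nat.find (hex v)
  have hidx : ∀ v, ((σ * α) ^ idx v) (base (comp v)) = out v := fun v => Nat.find_spec (hex v)
  have hmin : ∀ v, ∀ n < idx v, ((σ * α) ^ n) (base (comp v)) ≠ out v := fun v n hn =>
    Nat.find_min (hex v) hn
  have : Finite V := Finite.of_surjective vert hsurj
  obtain ⟨N, hN⟩ : ∃ N, ∀ v, idx v < N := by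
    obtain ⟨N, hN⟩ := (Set.finite_range idx).bddAbove
    exact ⟨N + 1, fun v => Nat.lt_succ_of_le (hN ⟨v, rfl⟩)⟩
  let num := Finite.equivFin (Quotient (orbitSetoid σ α))
  -- Each component occupies its own block of `N` positions; a vertex visited repeatedly is placed
  -- by its chosen corner `out v`.
  let pos : V → ℕ := fun v => num (comp v) * N + idx v
  have hlt : ∀ v w, pos v < pos w → (num (comp v) : ℕ) ≤ num (comp w) := by
    intro v w h
    by_contra! hc
    have h1 : ((num (comp w) : ℕ) + 1) * N ≤ num (comp v) * N := Nat.mul_le_mul_right _ hc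
    have h2 := hN w
    have h3 : pos v < pos w := h
    simp only [pos] at h3
    rw [add_mul, one_mul] at h1
    omega
  have hltidx : ∀ v w, comp v = comp w → pos v < pos w → idx v < idx w := by
    intro v w hvw h
    simp only [pos, hvw] at h
    omega
  refine ⟨pos, ?_, ?_⟩
  · intro v w h
    have hd : ∀ u, pos u / N = num (comp u) := fun u => by
      have := hN u
      simp only [pos]
      rw [mul_comm, Nat.mul_add_div (by omega), Nat.div_eq_of_lt this, add_zero]
    have hcvw : comp v = comp w := num.injective (Fin.ext (by rw [← hd, ← hd, h]))
    have hivw : idx v = idx w := by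
      simp only [pos, hcvw] at h
      omega
    rw [← hvout v, ← hvout w, ← hidx v, ← hidx w, hcvw, hivw]
  · intro e₁ e₂ e₃ e₄ h₁₂ h₂₃ h₃₄ hf₁ hf₂ h₁₃ h₂₄
    by_contra hne
    have k₁₃ := hin e₁ e₃ hf₁ h₁₃
    have k₂₄ := hin e₂ e₄ hf₂ h₂₄
    have c₁₃ : comp (vert e₁) = comp (vert e₃) := by
      rw [hcomp, hcomp]; exact Quotient.sound (orbitSetoid_of_mul k₁₃)
    have c₂₄ : comp (vert e₂) = comp (vert e₄) := by
      rw [hcomp, hcomp]; exact Quotient.sound (orbitSetoid_of_mul k₂₄)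
    -- Blocks are consecutive, so a vertex between two of one component belongs to it.
    have c₁₂ : comp (vert e₁) = comp (vert e₂) := by
      refine num.injective (Fin.ext (le_antisymm (hlt _ _ h₁₂) ?_))
      rw [c₁₃]
      exact hlt _ _ h₂₃
    have i₁₂ := hltidx _ _ c₁₂ h₁₂
    have i₂₃ := hltidx _ _ (c₁₂.symm.trans c₁₃) h₂₃
    have i₃₄ := hltidx _ _ ((c₁₃.symm.trans c₁₂).trans c₂₄) h₃₄
    have ne : ∀ {v w}, pos v < pos w → vert (out v) ≠ vert (out w) := by
      intro v w h h'
      rw [hvout, hvout] at h'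
      rw [h'] at h
      exact lt_irrefl _ h
    refine not_crossing_of_genus_zero hvert hface hgenus (b := base (comp (vert e₄)))
      i₁₂ i₂₃ i₃₄ ?_ (d₁ := out (vert e₁)) (d₂ := out (vert e₂)) (d₃ := out (vert e₃))
      (d₄ := out (vert e₄)) ?_ ?_ ?_ (hidx _) (hvout _).symm (hvout _).symm (hvout _).symm
      (hvout _).symm (ne h₁₂) (ne (h₁₂.trans h₂₃)) (ne (h₁₂.trans (h₂₃.trans h₃₄)))
      (ne h₂₃) (ne h₃₄) ?_ ?_ hne k₁₃ k₂₄
    · intro s t hst ht h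
      -- A repetition on the walk could be cut out, reaching `out (vert e₄)` before its first time.
      refine hmin (vert e₄) (idx (vert e₄) - (t - s)) (by omega) ?_
      rw [← hidx (vert e₄)]
      have e1 : idx (vert e₄) - (t - s) = (idx (vert e₄) - t) + s := by omega
      have e2 : idx (vert e₄) = (idx (vert e₄) - t) + t := by omega
      rw [e1]
      conv_rhs => rw [e2]
      rw [pow_add, pow_add, Perm.mul_apply, Perm.mul_apply, h]
    · rw [← c₂₄, ← c₁₂, hidx]
    · rw [← c₂₄, hidx]
    · rw [← c₂₄, ← c₁₂, c₁₃, hidx]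
    · rwa [hfbase]
    · rwa [hfbase]

end Order

/-! ### Segments and rays from a noncrossing order -/

section Geometry

variable {V F : Type*}

theorem not_isHorizontalSegment_ray (x y : ℝ) :
    ¬ IsHorizontalSegment {p : ℝ × ℝ | p.1 = x ∧ y ≤ p.2} := by
  rintro ⟨a, b, z, -, h⟩
  have h0 : (x, y) ∈ {p : ℝ × ℝ | p.1 = x ∧ y ≤ p.2} := ⟨rfl, le_rfl⟩
  have h1 : (x, y + 1) ∈ {p : ℝ × ℝ | p.1 = x ∧ y ≤ p.2} := ⟨rfl, by simp⟩
  rw [h] at h0 h1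
  have e0 : y = z := h0.2.2
  have e1 : y + 1 = z := h1.2.2
  linarith

theorem not_isUpwardRay_segment (a b z : ℝ) :
    ¬ IsUpwardRay {p : ℝ × ℝ | a ≤ p.1 ∧ p.1 ≤ b ∧ p.2 = z} := by
  rintro ⟨x, y, h⟩
  have h0 : (x, y) ∈ {p : ℝ × ℝ | p.1 = x ∧ y ≤ p.2} := ⟨rfl, le_rfl⟩
  have h1 : (x, y + 1) ∈ {p : ℝ × ℝ | p.1 = x ∧ y ≤ p.2} := ⟨rfl, by simp⟩
  rw [← h] at h0 h1
  have e0 : y = z := h0.2.2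
  have e1 : y + 1 = z := h1.2.2
  linarith

/-- A bipartite graph with parts `V` and `F` is a SegRay graph if there are rays for `V` and
segments for `F`, given by their coordinates, that represent it. -/
theorem isSegRayGraph_of_coordinates (H : SimpleGraph (V ⊕ F))
    (hV : ∀ v w, ¬ H.Adj (Sum.inl v) (Sum.inl w)) (hF : ∀ f g, ¬ H.Adj (Sum.inr f) (Sum.inr g))
    (x y : V → ℝ) (a b h : F → ℝ) (hx : Function.Injective x) (hh : Function.Injective h)
    (hab : ∀ f, a f < b f)
    (hadj : ∀ v f, H.Adj (Sum.inl v) (Sum.inr f) ↔ a f ≤ x v ∧ x v ≤ b f ∧ y v ≤ h f) :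
    IsSegRayGraph H := by
  have hdV : ∀ v w, v ≠ w → Disjoint {p : ℝ × ℝ | p.1 = x v ∧ y v ≤ p.2}
      {p : ℝ × ℝ | p.1 = x w ∧ y w ≤ p.2} := by
    intro v w hvw
    rw [Set.disjoint_left]
    rintro p ⟨h1, -⟩ ⟨h2, -⟩
    exact hvw (hx (h1.symm.trans h2))
  have hdF : ∀ f g, f ≠ g → Disjoint {p : ℝ × ℝ | a f ≤ p.1 ∧ p.1 ≤ b f ∧ p.2 = h f}
      {p : ℝ × ℝ | a g ≤ p.1 ∧ p.1 ≤ b g ∧ p.2 = h g} := by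
    intro f g hfg
    rw [Set.disjoint_left]
    rintro p ⟨-, -, h1⟩ ⟨-, -, h2⟩
    exact hfg (hh (h1.symm.trans h2))
  have hmeet : ∀ v f, H.Adj (Sum.inl v) (Sum.inr f) ↔
      ({p : ℝ × ℝ | p.1 = x v ∧ y v ≤ p.2} ∩
        {p : ℝ × ℝ | a f ≤ p.1 ∧ p.1 ≤ b f ∧ p.2 = h f}).Nonempty := by
    intro v f
    rw [hadj]
    constructor
    · rintro ⟨h1, h2, h3⟩
      exact ⟨(x v, h f), ⟨rfl, h3⟩, h1, h2, rfl⟩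
    · rintro ⟨p, ⟨h1, h2⟩, h3, h4, h5⟩
      rw [h1] at h3 h4
      rw [h5] at h2
      exact ⟨h3, h4, h2⟩
  refine ⟨Sum.elim (fun v => {p | p.1 = x v ∧ y v ≤ p.2})
    (fun f => {p | a f ≤ p.1 ∧ p.1 ≤ b f ∧ p.2 = h f}), ?_, ?_, ?_⟩
  · rintro (v | f)
    · exact Or.inr ⟨x v, y v, rfl⟩
    · exact Or.inl ⟨a f, b f, h f, hab f, rfl⟩
  · rintro (v | f) (w | g) hne hpar
    · exact hdV v w fun e => hne (congrArg _ e)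
    · rcases hpar with ⟨h1, -⟩ | ⟨-, h2⟩
      · exact absurd h1 (not_isHorizontalSegment_ray _ _)
      · exact absurd h2 (not_isUpwardRay_segment _ _ _)
    · rcases hpar with ⟨-, h1⟩ | ⟨h2, -⟩
      · exact absurd h1 (not_isHorizontalSegment_ray _ _)
      · exact absurd h2 (not_isUpwardRay_segment _ _ _)
    · exact hdF f g fun e => hne (congrArg _ e)
  · rintro (v | f) (w | g)
    · refine iff_of_false (hV v w) ?_
      rintro ⟨hne, hn⟩
      exact Set.not_disjoint_iff_nonempty_inter.2 hn (hdV v w fun e => hne (congrArg _ e))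
    · exact (hmeet v g).trans (by simp)
    · rw [H.adj_comm, hmeet, Set.inter_comm]
      simp
    · refine iff_of_false (hF f g) ?_
      rintro ⟨hne, hn⟩
      exact Set.not_disjoint_iff_nonempty_inter.2 hn (hdF f g fun e => hne (congrArg _ e))

variable [Finite V] [Finite F]

/-- If the sets of vertices of inner faces are pairwise noncrossing in a linear order, then faces
have different heights such that a face that has a vertex strictly inside a gap of an inner face
`f` lies above `f`. -/
theorem exists_height {I : V → F → Prop} {outer : F} {pos : V → ℕ}
    (hpos : Function.Injective pos) {lo hi : F → V}
    (hlo : ∀ f, I (lo f) f) (hhi : ∀ f, I (hi f) f)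
    (hle : ∀ v f, I v f → pos (lo f) ≤ pos v ∧ pos v ≤ pos (hi f))
    (hcross : ∀ f g v₁ v₂ v₃ v₄, pos v₁ < pos v₂ → pos v₂ < pos v₃ → pos v₃ < pos v₄ →
      f ≠ outer → g ≠ outer → I v₁ f → I v₃ f → I v₂ g → I v₄ g → f = g) :
    ∃ h : F → ℝ, Function.Injective h ∧ ∀ f g v, f ≠ outer → I v g → ¬ I v f →
      pos (lo f) < pos v → pos v < pos (hi f) → h f < h g := by
  classical
  let N : ℤ := Nat.card V + 1
  let len : F → ℤ := fun f => pos (hi f) - pos (lo f)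
  let size : F → ℤ := fun f => Nat.card {v // I v f}
  have hsize : ∀ f, size f < N := fun f => by
    have := Finite.card_subtype_le (fun v => I v f)
    simp only [size, N]
    omega
  have hsize0 : ∀ f, 0 ≤ size f := fun f => Int.natCast_nonneg _
  have hlen0 : ∀ f, 0 ≤ len f := fun f => by
    have := (hle _ _ (hlo f)).2
    simp only [len]
    omega
  -- Since `N` exceeds every `size`, inner faces are compared lexicographically: longer span lower,
  -- then fewer vertices lower. The outer face is on top.
  let key : F → ℤ := fun f => if f = outer then N else size f - N * len f
  have hkey : ∀ f g v, f ≠ outer → I v g → ¬ I v f →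
      pos (lo f) < pos v → pos v < pos (hi f) → key f < key g := by
    intro f g v hf hg hnf h1 h2
    have hfg : f ≠ g := by rintro rfl; exact hnf hg
    simp only [key, if_neg hf]
    have hs := hsize f
    have hN0 : 0 < N := (hsize0 f).trans_lt hs
    split_ifs with hgo
    · nlinarith [hlen0 f]
    -- the gap of `f` that contains `v`
    obtain ⟨u, ⟨huf, huv⟩, humax⟩ := Set.exists_max_image {u | I u f ∧ pos u < pos v} pos
      (Set.toFinite _) ⟨lo f, hlo f, h1⟩
    obtain ⟨w, ⟨hwf, hvw⟩, hwmin⟩ := Set.exists_min_image {w | I w f ∧ pos v < pos w} pos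
      (Set.toFinite _) ⟨hi f, hhi f, h2⟩
    -- A vertex of `g` beyond `u` or `w` would interleave with `u`, `v`, `w`.
    have hsub : ∀ z, I z g → pos u ≤ pos z ∧ pos z ≤ pos w := by
      intro z hz
      constructor
      · by_contra! hlt
        exact hfg (hcross g f z u v w hlt huv hvw hgo hf hz hg huf hwf).symm
      · by_contra! hlt
        exact hfg (hcross f g u v w z huv hvw hlt hf hgo huf hwf hg hz)
    have b1 := (hsub _ (hlo g)).1
    have b2 := (hsub _ (hhi g)).2
    have b3 := (hle _ _ huf).1
    have b4 := (hle _ _ hwf).2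
    have hlen : len g ≤ len f := by simp only [len]; omega
    rcases hlen.lt_or_eq with hlt | heq
    · have : N * len g + N ≤ N * len f := by nlinarith
      have := hsize0 g
      linarith
    · rw [heq]
      -- Equal spans force the gap to be the whole span: `f` has only its two end vertices, which
      -- `g` shares, and `g` also has `v`.
      have e : pos u = pos (lo f) ∧ pos w = pos (hi f) ∧ pos (lo g) = pos u ∧
          pos (hi g) = pos w := by
        simp only [len] at heq
        omega
      have hlou := hpos e.2.2.1
      have hhiw := hpos e.2.2.2
      have hlt : {z | I z f} ⊂ {z | I z g} := by
        rw [Set.ssubset_iff_of_subset]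
        · exact ⟨v, hg, hnf⟩
        · intro z hz
          have hzne : pos z ≠ pos v := fun h => hnf (hpos h ▸ hz)
          have hz1 := hle _ _ hz
          rcases Nat.lt_or_gt_of_ne hzne with h | h
          · have := humax z ⟨hz, h⟩
            have hzu : z = u := hpos (by omega)
            rw [hzu, ← hlou]
            exact hlo g
          · have := hwmin z ⟨hz, h⟩
            have hzw : z = w := hpos (by omega)
            rw [hzw, ← hhiw]
            exact hhi g
      have hcard := Set.ncard_lt_ncard hlt (Set.toFinite _)
      have : size f < size g := by
        simp only [size]
        exact_mod_cast hcard
      linarith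
  let num := Finite.equivFin F
  let n : ℤ := Nat.card F
  have hnum : ∀ f, (num f : ℤ) < n := fun f => by
    have := (num f).2
    simp only [n]
    exact_mod_cast this
  have hmono : ∀ f g, key f < key g → n * key f + num f < n * key g + num g := by
    intro f g hfg
    have h1 := hnum f
    have h2 : (0 : ℤ) ≤ num g := Int.natCast_nonneg _
    have h3 : (0 : ℤ) ≤ num f := Int.natCast_nonneg _
    nlinarith
  -- The numbering breaks ties between equal keys, making heights distinct.
  refine ⟨fun f => ((n * key f + num f : ℤ) : ℝ), fun f g hfg => ?_,
    fun f g v hf hg hnf h1 h2 => ?_⟩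
  · have hfg' : n * key f + num f = n * key g + num g :=
      Int.cast_injective hfg
    have hk : key f = key g := by
      rcases lt_trichotomy (key f) (key g) with h | h | h
      · exact absurd hfg' (hmono _ _ h).ne
      · exact h
      · exact absurd hfg' (hmono _ _ h).ne'
    rw [hk] at hfg'
    exact num.injective (Fin.ext (by omega))
  · exact Int.cast_lt.2 (hmono _ _ (hkey f g v hf hg hnf h1 h2))

/-- If `v` lies in the span of `f` but not on `f`, then all faces at `v`, in particular the lowest
one, where its ray starts, are above `f`. The outer face contains all vertices and needs no such
check. -/
theorem isSegRayGraph_of_noncrossing (H : SimpleGraph (V ⊕ F))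
    (hV : ∀ v w, ¬ H.Adj (Sum.inl v) (Sum.inl w)) (hF : ∀ f g, ¬ H.Adj (Sum.inr f) (Sum.inr g))
    {I : V → F → Prop} (hI : ∀ v f, H.Adj (Sum.inl v) (Sum.inr f) ↔ I v f) {outer : F}
    (houter : ∀ v, I v outer) (hne : ∀ f, ∃ v, I v f) {pos : V → ℕ}
    (hpos : Function.Injective pos)
    (hcross : ∀ f g v₁ v₂ v₃ v₄, pos v₁ < pos v₂ → pos v₂ < pos v₃ → pos v₃ < pos v₄ →
      f ≠ outer → g ≠ outer → I v₁ f → I v₃ f → I v₂ g → I v₄ g → f = g) :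
    IsSegRayGraph H := by
  classical
  have hlo : ∀ f, ∃ u, I u f ∧ ∀ v, I v f → pos u ≤ pos v := fun f => by
    obtain ⟨u, hu, h⟩ := Set.exists_min_image {v | I v f} pos (Set.toFinite _) (hne f)
    exact ⟨u, hu, h⟩
  have hhi : ∀ f, ∃ u, I u f ∧ ∀ v, I v f → pos v ≤ pos u := fun f => by
    obtain ⟨u, hu, h⟩ := Set.exists_max_image {v | I v f} pos (Set.toFinite _) (hne f)
    exact ⟨u, hu, h⟩
  choose lo hlo hlo' using hlo
  choose hi hhi hhi' using hhi
  obtain ⟨h, hh, hlt⟩ := exists_height (outer := outer) hpos hlo hhi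
    (fun v f hvf => ⟨hlo' f v hvf, hhi' f v hvf⟩) hcross
  have hlow : ∀ v, ∃ f, I v f ∧ ∀ g, I v g → h f ≤ h g := fun v => by
    obtain ⟨f, hf, hf'⟩ := Set.exists_min_image {f | I v f} h (Set.toFinite _) ⟨outer, houter v⟩
    exact ⟨f, hf, hf'⟩
  choose low hlow hlow' using hlow
  refine isSegRayGraph_of_coordinates H hV hF (fun v => (pos v : ℝ)) (fun v => h (low v))
    -- The margin 1/2 gives positive length even to a face with a single vertex, and reaches no
    -- further integer position.
    (fun f => (pos (lo f) : ℝ) - 1 / 2) (fun f => (pos (hi f) : ℝ) + 1 / 2) h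
    (fun v w hvw => hpos (Nat.cast_injective hvw)) hh (fun f => ?_) (fun v f => ?_)
  · have : (pos (lo f) : ℝ) ≤ pos (hi f) := Nat.cast_le.2 (hlo' f _ (hhi f))
    linarith
  · rw [hI]
    constructor
    · intro hvf
      have h1 : (pos (lo f) : ℝ) ≤ pos v := Nat.cast_le.2 (hlo' f _ hvf)
      have h2 : (pos v : ℝ) ≤ pos (hi f) := Nat.cast_le.2 (hhi' f _ hvf)
      exact ⟨by linarith, by linarith, hlow' v f hvf⟩
    · rintro ⟨h1, h2, h3⟩
      by_contra hvf
      have hfo : f ≠ outer := by rintro rfl; exact hvf (houter v)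
      have h1' : pos (lo f) ≤ pos v := by
        have : (pos (lo f) : ℝ) < pos v + 1 := by linarith
        exact Nat.lt_succ_iff.1 (by exact_mod_cast this)
      have h2' : pos v ≤ pos (hi f) := by
        have : (pos v : ℝ) < pos (hi f) + 1 := by linarith
        exact Nat.lt_succ_iff.1 (by exact_mod_cast this)
      refine absurd (hlt f (low v) v hfo (hlow v) hvf (lt_of_le_of_ne h1' fun e => ?_)
        (lt_of_le_of_ne h2' fun e => ?_)) (not_lt.2 h3)
      · exact hvf (hpos e ▸ hlo f)
      · exact hvf (hpos e ▸ hhi f)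

end Geometry

/-! ### Corners of a map and the counts in Euler's formula -/

namespace FacedMap

variable {V D F : Type*} (M : FacedMap V D F)

/-- A corner of a map: a dart, or an isolated vertex. -/
abbrev Corner : Type _ := D ⊕ {v : V // ∀ d, M.vert d ≠ v}

/-- The vertex of a corner. -/
def cornerVert : M.Corner → V := Sum.elim M.vert Subtype.val

/-- The face of a corner. -/
def cornerFace : M.Corner → F := Sum.elim M.dartFace M.isolatedFace

/-- The rotation, extended to all corners. -/
def cornerRot : Perm M.Corner := Perm.sumCongr M.rot 1

/-- The edge involution, extended to all corners. -/
def cornerInv : Perm M.Corner := Perm.sumCongr (Function.Involutive.toPerm M.inv M.inv_inv) 1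

theorem incident_iff {v : V} {f : F} :
    M.Incident v f ↔ ∃ k, M.cornerVert k = v ∧ M.cornerFace k = f := by
  constructor
  · rintro (⟨d, h⟩ | ⟨h, h'⟩)
    · exact ⟨Sum.inl d, h⟩
    · exact ⟨Sum.inr ⟨v, h⟩, rfl, h'⟩
  · rintro ⟨d | ⟨w, hw⟩, h, h'⟩
    · exact Or.inl ⟨d, h, h'⟩
    · obtain rfl : w = v := h
      exact Or.inr ⟨hw, h'⟩

theorem cornerVert_surjective : Function.Surjective M.cornerVert := by
  intro v
  by_cases h : ∀ d, M.vert d ≠ v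
  · exact ⟨Sum.inr ⟨v, h⟩, rfl⟩
  · push Not at h
    obtain ⟨d, hd⟩ := h
    exact ⟨Sum.inl d, hd⟩

theorem cornerVert_eq_iff (a b : M.Corner) :
    M.cornerVert a = M.cornerVert b ↔ SameCycle M.cornerRot a b := by
  constructor
  · rcases a with d | ⟨v, hv⟩ <;> rcases b with e | ⟨w, hw⟩ <;> intro h
    · obtain ⟨n, hn⟩ := (M.vert_eq_iff d e).1 h
      refine (sameCycle_setoid_le_iff
        (r := (SameCycle.setoid M.cornerRot).comap Sum.inl)).2 (fun a => ?_) ⟨n, hn⟩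
      exact ⟨1, by simp [cornerRot]⟩
    · exact absurd h (hw d)
    · exact absurd h.symm (hv e)
    · obtain rfl : v = w := h
      exact SameCycle.refl _ _
  · refine fun h => (sameCycle_setoid_le_iff (r := Setoid.ker M.cornerVert)).2 ?_ h
    rintro (d | v)
    · exact (M.vert_eq_iff _ _).2 ⟨1, by simp⟩
    · rfl

theorem cornerFace_next (a : M.Corner) :
    M.cornerFace ((M.cornerRot * M.cornerInv) a) = M.cornerFace a := by
  rcases a with d | v
  · exact M.dartFace_next d
  · rfl

theorem sameCycle_cornerInv {d : D} {b : M.Corner} (h : SameCycle M.cornerInv (Sum.inl d) b) :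
    b = Sum.inl d ∨ b = Sum.inl (M.inv d) := by
  have hinv : M.cornerInv ^ 2 = 1 := by
    ext a
    rcases a with e | v
    · exact congrArg Sum.inl (M.inv_inv e)
    · rfl
  obtain ⟨n, rfl⟩ := h
  rcases Int.even_or_odd' n with ⟨m, rfl | rfl⟩
  · left
    rw [zpow_mul, zpow_ofNat, hinv, one_zpow, Perm.one_apply]
  · right
    rw [zpow_add, zpow_mul, zpow_ofNat, hinv, one_zpow, one_mul, zpow_one]
    rfl

theorem sameCycle_cornerInv_isolated {v : {v : V // ∀ d, M.vert d ≠ v}} {b : M.Corner}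
    (h : SameCycle M.cornerInv (Sum.inr v) b) : b = Sum.inr v := by
  obtain ⟨n, rfl⟩ := h
  exact zpow_apply_eq_self_of_apply_eq_self rfl n

variable [Finite V]

/-- Adjacent vertices have corners in one orbit, so components map onto orbits. Only this inequality
is needed. -/
theorem numClasses_orbitSetoid_le :
    (orbitSetoid M.cornerRot M.cornerInv).numClasses ≤
      Nat.card M.underlyingGraph.ConnectedComponent := by
  let r := orbitSetoid M.cornerRot M.cornerInv
  choose corner hcorner using M.cornerVert_surjective
  have hr : ∀ a b, M.cornerVert a = M.cornerVert b → r a b := fun a b h =>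
    orbitSetoid_of_left ((M.cornerVert_eq_iff a b).1 h)
  have hdart : ∀ d, r (corner (M.vert d)) (corner (M.vert (M.inv d))) := fun d => by
    have h1 : r (corner (M.vert d)) (Sum.inl d) := hr _ _ (hcorner _)
    have h2 : r (Sum.inl (M.inv d)) (corner (M.vert (M.inv d))) := hr _ _ (hcorner _).symm
    have h3 : r (Sum.inl d) (Sum.inl (M.inv d)) :=
      orbitSetoid_of_right ⟨1, rfl⟩
    exact r.trans h1 (r.trans h3 h2)
  have hadj : ∀ u v, M.underlyingGraph.Adj u v → r (corner u) (corner v) := by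
    rintro u v ⟨-, ⟨d, rfl, rfl⟩ | ⟨d, rfl, rfl⟩⟩
    · exact hdart d
    · exact r.symm (hdart d)
  have hwalk : ∀ u v, M.underlyingGraph.Walk u v → r (corner u) (corner v) := by
    intro u v p
    induction p with
    | nil => exact r.refl _
    | cons h _ ih => exact r.trans (hadj _ _ h) ih
  let g : M.underlyingGraph.ConnectedComponent → Quotient r :=
    SimpleGraph.ConnectedComponent.lift (fun v => Quotient.mk r (corner v))
      fun u v p _ => Quotient.sound (hwalk u v p)
  have : Finite M.underlyingGraph.ConnectedComponent := Quot.finite _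
  refine Nat.card_le_card_of_surjective g fun q => ?_
  induction q using Quotient.inductionOn with | _ a
  exact ⟨M.underlyingGraph.connectedComponentMk (M.cornerVert a),
    Quotient.sound (hr _ _ (hcorner _))⟩

variable [Finite D]

theorem card_le_cycleCount_cornerInv :
    Nat.card D + 2 * Nat.card {v : V // ∀ d, M.vert d ≠ v} ≤ 2 * cycleCount M.cornerInv := by
  -- On a cycle of darts the Boolean selects the representative or its inverse; on an isolated
  -- corner it is kept, whence the factor 2.
  let g : Quotient (SameCycle.setoid M.cornerInv) × Bool →
      D ⊕ {v : V // ∀ d, M.vert d ≠ v} × Bool := fun p =>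
    Sum.elim (fun d => Sum.inl (cond p.2 d (M.inv d))) (fun v => Sum.inr (v, p.2)) p.1.out
  have hg : Function.Surjective g := by
    rintro (d | ⟨v, b⟩)
    · let q : Quotient (SameCycle.setoid M.cornerInv) := Quotient.mk _ (Sum.inl d)
      have hq : SameCycle M.cornerInv (Sum.inl d) q.out :=
        SameCycle.symm (Quotient.exact (Quotient.out_eq q))
      rcases M.sameCycle_cornerInv hq with h | h
      · exact ⟨(q, true), by simp [g, h]⟩
      · exact ⟨(q, false), by simp [g, h, M.inv_inv]⟩
    · let q : Quotient (SameCycle.setoid M.cornerInv) := Quotient.mk _ (Sum.inr v)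
      have hq : SameCycle M.cornerInv (Sum.inr v) q.out :=
        SameCycle.symm (Quotient.exact (Quotient.out_eq q))
      exact ⟨(q, b), by simp [g, M.sameCycle_cornerInv_isolated hq]⟩
  have h := Nat.card_le_card_of_surjective g hg
  rw [Nat.card_sum, Nat.card_prod, Nat.card_prod, Nat.card_eq_fintype_card (α := Bool),
    Fintype.card_bool] at h
  have e : cycleCount M.cornerInv = Nat.card (Quotient (SameCycle.setoid M.cornerInv)) := rfl
  omega

end FacedMap

/-! ### The comparability graph and the theorem -/

section Comparability

variable {V D F : Type*} (M : FacedMap V D F)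

theorem comparabilityGraph_adj_vertex_face (v : V) (f : F) :
    (comparabilityGraph M.VertexFace).Adj (Sum.inl v : V ⊕ F) (Sum.inr f : V ⊕ F) ↔
      M.Incident v f := by
  constructor
  · rintro ⟨-, (h | ⟨w, g, h1, h2, h⟩) | (h | ⟨w, g, h1, h2, h⟩)⟩
    · cases h
    · cases h1; cases h2; exact h
    · cases h
    · cases h1
  · intro h
    exact ⟨Sum.inl_ne_inr, Or.inl (Or.inr ⟨v, f, rfl, rfl, h⟩)⟩

theorem not_comparabilityGraph_adj_vertices (v w : V) :
    ¬ (comparabilityGraph M.VertexFace).Adj (Sum.inl v : V ⊕ F) (Sum.inl w : V ⊕ F) := by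
  rintro ⟨hne, (h | ⟨_, _, h1, h2, h⟩) | (h | ⟨_, _, h1, h2, h⟩)⟩
  · exact hne h
  · cases h2
  · exact hne h.symm
  · cases h2

theorem not_comparabilityGraph_adj_faces (f g : F) :
    ¬ (comparabilityGraph M.VertexFace).Adj (Sum.inr f : V ⊕ F) (Sum.inr g : V ⊕ F) := by
  rintro ⟨hne, (h | ⟨_, _, h1, h2, h⟩) | (h | ⟨_, _, h1, h2, h⟩)⟩
  · exact hne h
  · cases h1
  · exact hne h.symm
  · cases h1

end Comparability

/-- If a plane map has a vertex, then every face has a vertex on its boundary. -/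
theorem PlaneMap.exists_incident {V D F : Type*} (M : PlaneMap V D F) [Nonempty V] (f : F) :
    ∃ v, M.Incident v f := by
  obtain ⟨v⟩ := ‹Nonempty V›
  let H := comparabilityGraph M.VertexFace
  have hreach : H.Reachable (Sum.inr f : V ⊕ F) (Sum.inl v : V ⊕ F) := M.connected.preconnected _ _
  obtain ⟨p⟩ := hreach
  cases p with
  | @cons _ w _ h q =>
    rcases w with w | g
    · exact ⟨w, (comparabilityGraph_adj_vertex_face _ w f).1 h.symm⟩
    · exact absurd h (not_comparabilityGraph_adj_faces _ f g)

/-- The only map without vertices has a single face. -/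
theorem PlaneMap.face_eq_of_isEmpty {V D F : Type*} (M : PlaneMap V D F) [IsEmpty V] (f g : F) :
    f = g := by
  let H := comparabilityGraph M.VertexFace
  have hreach : H.Reachable (Sum.inr f : V ⊕ F) (Sum.inr g : V ⊕ F) := M.connected.preconnected _ _
  obtain ⟨p⟩ := hreach
  cases p with
  | nil => rfl
  | @cons _ w _ h q =>
    rcases w with w | k
    · exact isEmptyElim w
    · exact absurd h (not_comparabilityGraph_adj_faces _ f k)

theorem mainTheorem2 {V D F : Type*} [Finite V] [Finite D] [Finite F]
    (M : PlaneMap V D F) (hM : M.IsOuterplanar) :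
    IsSegRayGraph (comparabilityGraph M.VertexFace) := by
  rcases isEmpty_or_nonempty V with hV | hV
  · exact isSegRayGraph_of_coordinates (comparabilityGraph M.VertexFace)
      (not_comparabilityGraph_adj_vertices _) (not_comparabilityGraph_adj_faces _)
      isEmptyElim isEmptyElim (fun _ => 0) (fun _ => 1) (fun _ => 0)
      (fun v => isEmptyElim v) (fun f g _ => M.face_eq_of_isEmpty f g) (fun _ => one_pos)
      (fun v => isEmptyElim v)
  -- Each isolated vertex adds one corner and one cycle of the edge flip, so its contributions
  -- cancel.
  have heuler : Nat.card M.Corner + (orbitSetoid M.cornerRot M.cornerInv).numClasses + 1 ≤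
      Nat.card V + cycleCount M.cornerInv + Nat.card F := by
    have h1 := M.euler
    have h2 := M.card_le_cycleCount_cornerInv
    have h3 := M.numClasses_orbitSetoid_le
    have h4 : Nat.card M.Corner = Nat.card D + Nat.card {v : V // ∀ d, M.vert d ≠ v} :=
      Nat.card_sum
    omega
  obtain ⟨pos, hpos, hcross⟩ := exists_noncrossing_order (outer := M.outer) M.cornerVert_eq_iff
    M.cornerVert_surjective M.cornerFace_next
    (fun f => by
      obtain ⟨v, hv⟩ := M.exists_incident f
      obtain ⟨k, -, hk⟩ := M.incident_iff.1 hv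
      exact ⟨k, hk⟩)
    (fun v => M.incident_iff.1 (hM v)) heuler
  refine isSegRayGraph_of_noncrossing (comparabilityGraph M.VertexFace)
    (not_comparabilityGraph_adj_vertices _) (not_comparabilityGraph_adj_faces _)
    (comparabilityGraph_adj_vertex_face _) hM M.exists_incident hpos ?_
  intro f g v₁ v₂ v₃ v₄ h₁₂ h₂₃ h₃₄ hf hg i₁ i₃ i₂ i₄
  obtain ⟨e₁, rfl, rfl⟩ := M.incident_iff.1 i₁
  obtain ⟨e₂, rfl, rfl⟩ := M.incident_iff.1 i₂
  obtain ⟨e₃, rfl, h₃⟩ := M.incident_iff.1 i₃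
  obtain ⟨e₄, rfl, h₄⟩ := M.incident_iff.1 i₄
  exact hcross e₁ e₂ e₃ e₄ h₁₂ h₂₃ h₃₄ hf hg h₃.symm h₄.symm
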